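/- Let $q$ be a fixed odd prime power. For $n \ge 0$ let $O(2n+1,q)$ be the orthogonal group of a nondegenerate quadratic form $Q_n$ on $\mathbb{F}_q^{2n+1}$, that is, the group of all invertible linear maps $g$ with $Q_n(gx)=Q_n(x)$ for all $x$, and let $i_O(2n+1,q)$ be the number of elements $g\in O(2n+1,q)$ with $g^2=1$ (the identity is counted as an involution; this does not affect the limit). Then, for every choice of the nondegenerate forms $Q_n$, \[ \lim_{n\to\infty} \frac{i_O(2n+1,q)}{q^{n^2+n}} = 2\prod_{i\ge 1}\left(1+\frac{1}{q^{2i}}\right)^2, \] where the infinite product converges. -/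

import Mathlib

open Filter Topology

/-- The orthogonal group of a quadratic form `Q`: the subgroup of all linear automorphisms `g` of
the underlying space with `Q (g x) = Q x` for all `x`. -/
def quadraticOrthogonalGroup {K V : Type*} [Field K] [AddCommGroup V] [Module K V]
    (Q : QuadraticForm K V) : Subgroup (V ≃ₗ[K] V) where
  carrier := {g | ∀ x, Q (g x) = Q x}
  mul_mem' := by
    intro a b ha hb x
    exact (ha (b x)).trans (hb x)
  one_mem' := fun _ => rfl
  inv_mem' := by
    intro a ha x
    have h := ha (a⁻¹ x)
    have e : a (a⁻¹ x) = x := a.apply_symm_apply x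
    rw [e] at h
    exact h.symm

/-- The number of elements `g` of the orthogonal group of `Q` with `g ^ 2 = 1`
(the identity is counted). -/
noncomputable def involutionCount {K V : Type*} [Field K] [AddCommGroup V] [Module K V]
    (Q : QuadraticForm K V) : ℕ :=
  Nat.card {g : quadraticOrthogonalGroup Q // g ^ 2 = 1}

/-! In odd characteristic, `g` with `g ^ 2 = 1` is an orthogonal reflection: it is `1` on its fixed
space `W` and `-1` on the orthogonal complement. So the count is that of nondegenerate subspaces
(`involutionCount_eq_ncard`). As the total dimension is odd, complementation pairs even-dimensional
ones with odd-dimensional ones, giving the factor 2.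

Double counting hyperbolic pairs inside subspaces reduces dimension `2k + 1` to lines, and yields `q
^ (2j(2k+1))` times a Gaussian binomial in `x = q⁻²`, where `n = k + j`
(`ncard_nondegenerateSubspaces_eq`). Only odd dimensions are needed, and there all counts are
independent of the form.

Put `t = q⁻¹`. After division by `q ^ (n² + n)` the weight of the `k`-th term is `t ^ (m(m-1))`, `m
= n - 2k`. Dominated convergence replaces the binomial by `1/L`, `L = ∏ (1 - x ^ i)`, leaving a
theta sum over `m` of the parity of `n`. The substitution `m ↦ 1 - m` shows that both parities have
the same sum `T`. A special case of Jacobi's triple product, obtained as a limit of the `q`-binomial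
theorem, gives `2 ∏ (1 + x ^ i)² = 2T / L` (`tendsto_sum_qBinom_theta`). -/

namespace OrthogonalInvolutions

open LinearMap.BilinForm

/-! ### Double counting -/

section DoubleCounting

theorem ncard_mul_eq_ncard_mul {α β : Type*} [Finite α] [Finite β] (r : α → β → Prop)
    (s : Set α) (t : Set β) (m n : ℕ) (hm : ∀ a ∈ s, {b | b ∈ t ∧ r a b}.ncard = m)
    (hn : ∀ b ∈ t, {a | a ∈ s ∧ r a b}.ncard = n) : s.ncard * m = t.ncard * n := by
  classical
  have := Fintype.ofFinite α
  have := Fintype.ofFinite β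
  have h := Finset.card_mul_eq_card_mul (s := s.toFinset) (t := t.toFinset) (m := m) (n := n) r
    (fun a ha => by
      rw [← hm a (by simpa using ha), ← Set.ncard_coe_finset]
      congr 1; ext b; simp [Finset.bipartiteAbove])
    (fun b hb => by
      rw [← hn b (by simpa using hb), ← Set.ncard_coe_finset]
      congr 1; ext b; simp [Finset.bipartiteBelow])
  simpa [Set.ncard_eq_toFinset_card'] using h

end DoubleCounting

variable {F V : Type*} [Field F] [AddCommGroup V] [Module F V]

theorem ncard_submodule [FiniteDimensional F V] (U : Submodule F V) :
    (U : Set V).ncard = Nat.card F ^ Module.finrank F U := by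
  rw [← Module.natCard_eq_pow_finrank (K := F) (V := U)]
  rfl

/-! ### Splitting off a nondegenerate subspace -/

section Splitting

variable {B : LinearMap.BilinForm F V} {H U W : Submodule F V}

theorem sup_orthogonal_inf [FiniteDimensional F V] (hB : B.IsSymm)
    (hH : Disjoint H (B.orthogonal H)) (hHU : H ≤ U) : H ⊔ B.orthogonal H ⊓ U = U := by
  have h := ((isCompl_orthogonal_iff_disjoint hB.isRefl).2 hH).sup_eq_top
  rw [← sup_inf_assoc_of_le _ hHU, h, top_inf_eq]

theorem finrank_add_finrank_orthogonal_inf [FiniteDimensional F V] (hB : B.IsSymm)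
    (hH : Disjoint H (B.orthogonal H)) (hHU : H ≤ U) :
    Module.finrank F H + Module.finrank F (B.orthogonal H ⊓ U : Submodule F V) =
      Module.finrank F U := by
  have h := Submodule.finrank_sup_add_finrank_inf_eq H (B.orthogonal H ⊓ U)
  rw [sup_orthogonal_inf hB hH hHU, (hH.mono_right inf_le_left).eq_bot, finrank_bot] at h
  omega

theorem disjoint_orthogonal_sup (hB : B.IsSymm) (hH : Disjoint H (B.orthogonal H))
    (hW : Disjoint W (B.orthogonal W)) (hWH : W ≤ B.orthogonal H) :
    Disjoint (H ⊔ W) (B.orthogonal (H ⊔ W)) := by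
  rw [Submodule.disjoint_def] at *
  intro x hx hx'
  obtain ⟨h, hh, w, hw, rfl⟩ := Submodule.mem_sup.1 hx
  have h0 : h = 0 := by
    refine hH h hh fun y hy => ?_
    have h1 := hx' y (Submodule.mem_sup_left hy)
    have h2 := hWH hw y hy
    simp only [map_add] at h1 h2 ⊢
    simpa [h2] using h1
  have w0 : w = 0 := by
    refine hW w hw fun y hy => ?_
    have h1 := hx' y (Submodule.mem_sup_right hy)
    have h2 := hWH hy h hh
    rw [hB.eq] at h2
    simpa [h2] using h1
  simp [h0, w0]

theorem disjoint_orthogonal_of_compl [FiniteDimensional F V] (hB : B.IsSymm)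
    (hH : Disjoint H (B.orthogonal H))
    (hU : Disjoint U (B.orthogonal U)) (hHU : H ≤ U) :
    Disjoint (B.orthogonal H ⊓ U) (B.orthogonal (B.orthogonal H ⊓ U)) := by
  rw [Submodule.disjoint_def] at hU ⊢
  intro x hx hx'
  refine hU x hx.2 fun y hy => ?_
  rw [← sup_orthogonal_inf hB hH hHU] at hy
  obtain ⟨h, hh, w, hw, rfl⟩ := Submodule.mem_sup.1 hy
  have h1 := hx.1 h hh
  have h2 := hx' w hw
  simp [h1, h2]

/-- The subspaces of `U` of dimension `d` on which the form `B` is nondegenerate. -/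
def nondegenerateSubspaces (B : LinearMap.BilinForm F V) (U : Submodule F V) (d : ℕ) :
    Set (Submodule F V) :=
  {W | W ≤ U ∧ Disjoint W (B.orthogonal W) ∧ Module.finrank F W = d}

/-- A nondegenerate `W` containing `H` is the orthogonal sum of `H` and its complement in `W`, so
cutting with `B.orthogonal H` and adding `H` back are mutually inverse. -/
theorem ncard_nondegenerateSubspaces_ge [FiniteDimensional F V] (hB : B.IsSymm)
    (hH : Disjoint H (B.orthogonal H)) (hHU : H ≤ U) (d : ℕ) :
    {W | W ∈ nondegenerateSubspaces B U (Module.finrank F H + d) ∧ H ≤ W}.ncard =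
      (nondegenerateSubspaces B (B.orthogonal H ⊓ U) d).ncard := by
  refine Set.BijOn.ncard_eq (f := fun W => B.orthogonal H ⊓ W)
    (Set.InvOn.bijOn (f' := fun W => H ⊔ W) ⟨?_, ?_⟩ ?_ ?_)
  · rintro W ⟨-, hHW⟩
    exact sup_orthogonal_inf hB hH hHW
  · rintro W ⟨hWU, -, -⟩
    show B.orthogonal H ⊓ (H ⊔ W) = W
    rw [inf_comm, sup_comm, sup_inf_assoc_of_le _ (hWU.trans inf_le_left), hH.eq_bot, sup_bot_eq]
  · rintro W ⟨⟨hWU, hW, hd⟩, hHW⟩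
    have h := finrank_add_finrank_orthogonal_inf hB hH hHW
    exact ⟨inf_le_inf_left _ hWU, disjoint_orthogonal_of_compl hB hH hW hHW,
      show Module.finrank F (B.orthogonal H ⊓ W : Submodule F V) = d by omega⟩
  · rintro W ⟨hWU, hW, hd⟩
    have h := Submodule.finrank_sup_add_finrank_inf_eq H W
    rw [(hH.mono_right (hWU.trans inf_le_left)).eq_bot, finrank_bot] at h
    exact ⟨⟨sup_le hHU (hWU.trans inf_le_right),
      disjoint_orthogonal_sup hB hH hW (hWU.trans inf_le_left),
      show Module.finrank F (H ⊔ W : Submodule F V) = _ by omega⟩, le_sup_left⟩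

end Splitting

/-! ### Isotropic vectors and hyperbolic planes -/

section Hyperbolic

variable {B : LinearMap.BilinForm F V} {U : Submodule F V} {u v : V}

/-- The isotropic vectors of `U`, including zero. -/
def isotropicVectors (B : LinearMap.BilinForm F V) (U : Submodule F V) : Set V :=
  {v | v ∈ U ∧ B v v = 0}

/-- The pairs of isotropic vectors `u`, `v` of `U` with `B u v = 1`. -/
def hyperbolicPairs (B : LinearMap.BilinForm F V) (U : Submodule F V) : Set (V × V) :=
  {p | (p.1 ∈ U ∧ p.2 ∈ U) ∧ B p.1 p.1 = 0 ∧ B p.2 p.2 = 0 ∧ B p.1 p.2 = 1}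

/-- The orthogonal complement in `U` of the plane spanned by `u` and `v`. -/
abbrev planeCompl (B : LinearMap.BilinForm F V) (U : Submodule F V) (u v : V) : Submodule F V :=
  B.orthogonal (Submodule.span F {u, v}) ⊓ U

theorem mem_planeCompl (x : V) : x ∈ planeCompl B U u v ↔ (B u x = 0 ∧ B v x = 0) ∧ x ∈ U := by
  rw [Submodule.mem_inf, mem_orthogonal_iff]
  refine and_congr_left fun _ => ⟨fun h => ⟨?_, ?_⟩, ?_⟩
  · exact h u (Submodule.subset_span (by simp))
  · exact h v (Submodule.subset_span (by simp))
  · rintro ⟨h1, h2⟩ y hy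
    obtain ⟨a, b, rfl⟩ := Submodule.mem_span_pair.1 hy
    simp [h1, h2]

theorem disjoint_orthogonal_span_pair (hB : B.IsSymm) (h : (u, v) ∈ hyperbolicPairs B U) :
    Disjoint (Submodule.span F {u, v}) (B.orthogonal (Submodule.span F {u, v})) := by
  obtain ⟨-, huu, hvv, huv⟩ := h
  simp only at huu hvv huv
  rw [Submodule.disjoint_def]
  intro x hx hx'
  have h1 : B u x = 0 := hx' u (Submodule.subset_span (by simp))
  have h2 : B v x = 0 := hx' v (Submodule.subset_span (by simp))
  obtain ⟨a, b, rfl⟩ := Submodule.mem_span_pair.1 hx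
  have hvu : B v u = 1 := by rw [hB.eq, huv]
  simp [huu, hvv, huv, hvu] at h1 h2
  simp [h1, h2]

theorem finrank_span_pair (hB : B.IsSymm) (h : (u, v) ∈ hyperbolicPairs B U) :
    Module.finrank F (Submodule.span F {u, v}) = 2 := by
  obtain ⟨-, huu, hvv, huv⟩ := h
  simp only at huu hvv huv
  have hvu : B v u = 1 := by rw [hB.eq, huv]
  have hl : LinearIndependent F ![u, v] := by
    rw [LinearIndependent.pair_iff]
    intro a b hab
    have h1 : B u (a • u + b • v) = 0 := by simp [hab]
    have h2 : B v (a • u + b • v) = 0 := by simp [hab]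
    simp [huu, hvv, huv, hvu] at h1 h2
    exact ⟨h2, h1⟩
  have := finrank_span_eq_card hl
  rwa [Matrix.range_cons_cons_empty, Fintype.card_fin] at this

theorem span_pair_le (h : (u, v) ∈ hyperbolicPairs B U) : Submodule.span F {u, v} ≤ U := by
  rw [Submodule.span_le]
  rintro x (rfl | rfl)
  exacts [h.1.1, h.1.2]

theorem finrank_planeCompl [FiniteDimensional F V] (hB : B.IsSymm)
    (h : (u, v) ∈ hyperbolicPairs B U) :
    2 + Module.finrank F (planeCompl B U u v) = Module.finrank F U := by
  rw [← finrank_span_pair hB h]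
  exact finrank_add_finrank_orthogonal_inf hB (disjoint_orthogonal_span_pair hB h)
    (span_pair_le h)

theorem disjoint_orthogonal_planeCompl [FiniteDimensional F V] (hB : B.IsSymm)
    (hU : Disjoint U (B.orthogonal U)) (h : (u, v) ∈ hyperbolicPairs B U) :
    Disjoint (planeCompl B U u v) (B.orthogonal (planeCompl B U u v)) :=
  disjoint_orthogonal_of_compl hB (disjoint_orthogonal_span_pair hB h) hU (span_pair_le h)

/-- Nondegeneracy supplies a vector not orthogonal to `u`; scale it to pair to 1 with `u`, then
subtract the multiple of `u` that makes it isotropic. -/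
theorem exists_hyperbolic_partner (h2 : (2 : F) ≠ 0) (hB : B.IsSymm)
    (hU : Disjoint U (B.orthogonal U)) (hu : u ∈ isotropicVectors B U) (hu0 : u ≠ 0) :
    ∃ v, (u, v) ∈ hyperbolicPairs B U := by
  obtain ⟨huU, huu⟩ := hu
  obtain ⟨w, hw, hwu⟩ : ∃ w ∈ U, B w u ≠ 0 := by
    by_contra! hc
    exact hu0 (Submodule.disjoint_def.1 hU u huU hc)
  rw [hB.eq] at hwu
  set w' := (B u w)⁻¹ • w with hw'
  have h1 : B u w' = 1 := by simp [hw', hwu]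
  have h1' : B w' u = 1 := by rw [hB.eq, h1]
  refine ⟨w' - (B w' w' / 2) • u, ⟨huU, ?_⟩, huu, ?_, ?_⟩
  · exact U.sub_mem (U.smul_mem _ hw) (U.smul_mem _ huU)
  · simp [huu, h1, h1']
    field_simp
    ring
  · simp [huu, h1]

/-- If `U` were anisotropic, it would contain orthogonal nonisotropic `x`, `y`, `z`. Over a finite
field of odd order `B x x * s² + B y y * t² = -B z z` is solvable, so `s • x + t • y + z` is
isotropic. -/
theorem exists_isotropic [Finite F] [FiniteDimensional F V] (hodd : Odd (Nat.card F))
    (hB : B.IsSymm) (hd : 3 ≤ Module.finrank F U) :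
    ∃ u ∈ isotropicVectors B U, u ≠ 0 := by
  classical
  by_contra! hc
  have key : ∀ W : Submodule F V, W ≤ U → 0 < Module.finrank F W → ∃ x ∈ W, B x x ≠ 0 := by
    intro W hW h
    have : W ≠ ⊥ := by rintro rfl; simp at h
    obtain ⟨x, hx, hx0⟩ := Submodule.exists_mem_ne_zero_of_ne_bot this
    exact ⟨x, hx, fun h => hx0 (hc x ⟨hW hx, h⟩)⟩
  have step : ∀ W : Submodule F V, ∀ x ∈ W, B x x ≠ 0 →
      1 + Module.finrank F (B.orthogonal (Submodule.span F {x}) ⊓ W : Submodule F V) =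
        Module.finrank F W := by
    intro W x hx hxx
    have hx0 : x ≠ 0 := by rintro rfl; simp at hxx
    rw [← finrank_span_singleton (K := F) hx0]
    refine finrank_add_finrank_orthogonal_inf hB ?_ ?_
    · rw [disjoint_iff]; exact span_singleton_inf_orthogonal_eq_bot hxx
    · rwa [Submodule.span_singleton_le_iff_mem]
  obtain ⟨x, hx, hxx⟩ := key U le_rfl (by omega)
  have h1 := step U x hx hxx
  obtain ⟨y, hy, hyy⟩ := key _ inf_le_right (by omega :
    0 < Module.finrank F (B.orthogonal (Submodule.span F {x}) ⊓ U : Submodule F V))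
  have h3 := step _ y hy hyy
  obtain ⟨z, hz, hzz⟩ := key (B.orthogonal (Submodule.span F {y}) ⊓
    (B.orthogonal (Submodule.span F {x}) ⊓ U)) (inf_le_right.trans inf_le_right) (by omega)
  have hxy : B x y = 0 := hy.1 x (Submodule.mem_span_singleton_self x)
  have hyz : B y z = 0 := hz.1 y (Submodule.mem_span_singleton_self y)
  have hxz : B x z = 0 := hz.2.1 x (Submodule.mem_span_singleton_self x)
  have := Fintype.ofFinite F
  obtain ⟨s, t, hst⟩ := FiniteField.exists_root_sum_quadratic (R := F)
    (f := Polynomial.C (B x x) * Polynomial.X ^ 2 + Polynomial.C 0 * Polynomial.X +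
      Polynomial.C (B z z))
    (g := Polynomial.C (B y y) * Polynomial.X ^ 2 + Polynomial.C 0 * Polynomial.X +
      Polynomial.C 0) (Polynomial.degree_quadratic hxx) (Polynomial.degree_quadratic hyy)
    (by rw [← Nat.card_eq_fintype_card]; exact Nat.odd_iff.1 hodd)
  simp at hst
  have h0 : s • x + t • y + z = 0 := by
    refine hc _ ⟨U.add_mem (U.add_mem (U.smul_mem _ hx) (U.smul_mem _ hy.2)) hz.2.2, ?_⟩
    have hyx : B y x = 0 := by rw [hB.eq, hxy]
    have hzy : B z y = 0 := by rw [hB.eq, hyz]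
    have hzx : B z x = 0 := by rw [hB.eq, hxz]
    simp [hxy, hyz, hxz, hyx, hzy, hzx]
    linear_combination hst
  apply hzz
  have := congrArg (fun w => B w z) h0
  simpa [hxz, hyz] using this

end Hyperbolic

/-! ### Counting isotropic vectors, hyperbolic pairs and nondegenerate subspaces -/

section Counting

variable {F V : Type*} [Field F] [AddCommGroup V] [Module F V] [Finite V]
  {B : LinearMap.BilinForm F V} {U : Submodule F V} {u v : V}

/-- A partner of `u` has `v`-coefficient 1 and a free component `w` in the complement of the plane;
isotropy then forces its `u`-coefficient. -/
theorem ncard_hyperbolicPairs_fst (h2 : (2 : F) ≠ 0) (hB : B.IsSymm)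
    (h : (u, v) ∈ hyperbolicPairs B U) :
    {p | p ∈ hyperbolicPairs B U ∧ u = p.1}.ncard =
      Nat.card F ^ (Module.finrank F (planeCompl B U u v)) := by
  rw [← ncard_submodule]
  symm
  obtain ⟨⟨huU, hvU⟩, huu, hvv, huv⟩ := h
  simp only at huU hvU huu hvv huv
  have hvu : B v u = 1 := by rw [hB.eq, huv]
  refine Set.BijOn.ncard_eq (f := fun w => (u, v - (B w w / 2) • u + w))
    (Set.InvOn.bijOn (f' := fun p => p.2 - v - (B v p.2) • u) ⟨?_, ?_⟩ ?_ ?_)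
  · intro w hw
    obtain ⟨⟨huw, hvw⟩, -⟩ := (mem_planeCompl w).1 hw
    simp [hvv, hvu, hvw]
    module
  · rintro ⟨a, w⟩ ⟨⟨⟨-, -⟩, -, hww, huw⟩, rfl⟩
    simp only at hww huw
    have hwu : B w u = 1 := by rw [hB.eq, huw]
    have hwv : B w v = B v w := hB.eq _ _
    have : B (w - v - (B v w) • u) (w - v - (B v w) • u) = - (2 * B v w) := by
      simp [huu, hvv, hww, huv, hvu, huw, hwu, hwv]
      ring
    ext
    · rfl
    · simp only [this]
      rw [neg_div, mul_div_cancel_left₀ _ h2]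
      module
  · intro w hw
    obtain ⟨⟨huw, hvw⟩, hwU⟩ := (mem_planeCompl w).1 hw
    have hwu : B w u = 0 := by rw [hB.eq, huw]
    have hwv : B w v = 0 := by rw [hB.eq, hvw]
    refine ⟨⟨⟨huU, ?_⟩, huu, ?_, ?_⟩, rfl⟩
    · exact U.add_mem (U.sub_mem hvU (U.smul_mem _ huU)) hwU
    · simp [huu, hvv, huv, hvu, huw, hwu, hvw, hwv]
      field_simp
      ring
    · simp [huu, huv, huw]
  · rintro ⟨a, w⟩ ⟨⟨⟨-, hwU⟩, -, hww, huw⟩, rfl⟩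
    simp only at hww huw hwU
    refine (mem_planeCompl _).2 ⟨⟨?_, ?_⟩, ?_⟩
    · simp [huw, huv, huu]
    · simp [hvv, hvu]
    · exact U.sub_mem (U.sub_mem hwU hvU) (U.smul_mem _ huU)

variable [Finite F]

/-- Split by whether `B u w` vanishes. If so, the `u`-coefficient is free and the component in the
complement must be isotropic; if not, that component is free and the `u`-coefficient is forced. -/
theorem ncard_isotropicVectors_of_hyperbolic (h2 : (2 : F) ≠ 0) (hB : B.IsSymm)
    (h : (u, v) ∈ hyperbolicPairs B U) :
    (isotropicVectors B U).ncard =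
      Nat.card F * (isotropicVectors B (planeCompl B U u v)).ncard +
        (Nat.card F - 1) * Nat.card F ^ (Module.finrank F (planeCompl B U u v)) := by
  rw [← ncard_submodule]
  obtain ⟨⟨huU, hvU⟩, huu, hvv, huv⟩ := h
  simp only at huU hvU huu hvv huv
  have hvu : B v u = 1 := by rw [hB.eq, huv]
  have hsplit : isotropicVectors B U = {w | w ∈ isotropicVectors B U ∧ B u w = 0} ∪
      {w | w ∈ isotropicVectors B U ∧ B u w ≠ 0} := by
    ext w
    simp only [Set.mem_union, Set.mem_ofPred_eq]
    tauto
  have hdisj : Disjoint {w | w ∈ isotropicVectors B U ∧ B u w = 0}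
      {w | w ∈ isotropicVectors B U ∧ B u w ≠ 0} :=
    Set.disjoint_left.2 fun w h h' => h'.2 h.2
  rw [hsplit, Set.ncard_union_eq hdisj]
  congr 1
  · rw [← Set.ncard_univ, ← Set.ncard_prod]
    symm
    refine Set.BijOn.ncard_eq (f := fun p => p.1 • u + p.2)
      (Set.InvOn.bijOn (f' := fun w => (B v w, w - (B v w) • u)) ⟨?_, ?_⟩ ?_ ?_)
    · rintro ⟨a, w⟩ ⟨-, hw, hww⟩
      obtain ⟨⟨huw, hvw⟩, -⟩ := (mem_planeCompl w).1 hw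
      simp [hvu, hvw]
    · rintro w -
      simp
    · rintro ⟨a, w⟩ ⟨-, hw, hww⟩
      obtain ⟨⟨huw, hvw⟩, hwU⟩ := (mem_planeCompl w).1 hw
      simp only at huw hvw hww hwU
      have hwu : B w u = 0 := by rw [hB.eq, huw]
      refine ⟨⟨U.add_mem (U.smul_mem _ huU) hwU, ?_⟩, ?_⟩
      · simp [huu, huw, hwu, hww]
      · simp [huu, huw]
    · rintro w ⟨⟨hwU, hww⟩, huw⟩
      have hwu : B w u = 0 := by rw [hB.eq, huw]
      refine ⟨Set.mem_univ _, (mem_planeCompl _).2 ⟨⟨?_, ?_⟩, ?_⟩, ?_⟩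
      · simp [huu, huw]
      · simp [hvu]
      · exact U.sub_mem hwU (U.smul_mem _ huU)
      · simp [huu, huw, hwu, hww]
  · have hc : ({0}ᶜ : Set F).ncard = Nat.card F - 1 := by
      rw [Set.ncard_compl, Set.ncard_singleton]
    rw [← hc, ← Set.ncard_prod]
    symm
    refine Set.BijOn.ncard_eq (f := fun p => p.1 • v - (B p.2 p.2 / (2 * p.1)) • u + p.2)
      (Set.InvOn.bijOn (f' := fun w => (B u w, w - (B v w) • u - (B u w) • v)) ⟨?_, ?_⟩ ?_ ?_)
    · rintro ⟨b, w⟩ ⟨-, hw⟩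
      obtain ⟨⟨huw, hvw⟩, -⟩ := (mem_planeCompl w).1 hw
      simp [hvu, hvw, huw, huv, huu, hvv]
      module
    · rintro w ⟨⟨hwU, hww⟩, huw⟩
      have hwu : B w u = B u w := hB.eq _ _
      have hwv : B w v = B v w := hB.eq _ _
      have : B (w - (B v w) • u - (B u w) • v) (w - (B v w) • u - (B u w) • v) =
          - (B v w * (2 * B u w)) := by
        simp [huu, hvv, hww, huv, hvu, hwu, hwv]
        ring
      simp only [this]
      rw [neg_div, mul_div_cancel_right₀ _ (mul_ne_zero h2 huw)]
      module
    · rintro ⟨b, w⟩ ⟨hb, hw⟩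
      obtain ⟨⟨huw, hvw⟩, hwU⟩ := (mem_planeCompl w).1 hw
      simp only [Set.mem_compl_iff, Set.mem_singleton_iff] at huw hvw hwU hb
      have hwu : B w u = 0 := by rw [hB.eq, huw]
      have hwv : B w v = 0 := by rw [hB.eq, hvw]
      refine ⟨⟨U.add_mem (U.sub_mem (U.smul_mem _ hvU) (U.smul_mem _ huU)) hwU, ?_⟩, ?_⟩
      · simp [huu, hvv, huv, hvu, huw, hwu, hvw, hwv]
        field_simp
        ring
      · simpa [huu, huw, huv] using hb
    · rintro w ⟨⟨hwU, hww⟩, huw⟩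
      refine ⟨huw, (mem_planeCompl _).2 ⟨⟨?_, ?_⟩, ?_⟩⟩
      · simp [huu, huv]
      · simp [hvu, hvv]
      · exact U.sub_mem (U.sub_mem hwU (U.smul_mem _ huU)) (U.smul_mem _ hvU)

theorem two_ne_zero_of_odd_card (hodd : Odd (Nat.card F)) : (2 : F) ≠ 0 := by
  intro h
  have := Fintype.ofFinite F
  have h2 : ringChar F = 2 := CharP.ringChar_of_prime_eq_zero Nat.prime_two h
  have := FiniteField.even_card_iff_char_two.1 h2
  rw [← Nat.card_eq_fintype_card] at this
  rw [Nat.odd_iff] at hodd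
  omega

theorem ncard_isotropicVectors (hodd : Odd (Nat.card F)) (hB : B.IsSymm) (k : ℕ) :
    ∀ U : Submodule F V, Disjoint U (B.orthogonal U) → Module.finrank F U = 2 * k + 1 →
      (isotropicVectors B U).ncard = Nat.card F ^ (2 * k) := by
  have h2 := two_ne_zero_of_odd_card hodd
  induction k with
  | zero =>
    intro U hU hd
    have : isotropicVectors B U = {0} := by
      ext x
      refine ⟨fun ⟨hx, hxx⟩ => ?_, by rintro rfl; exact ⟨U.zero_mem, by simp⟩⟩
      by_contra hx0
      refine hx0 (Submodule.disjoint_def.1 hU x hx fun y hy => ?_)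
      obtain ⟨c, hc⟩ := (finrank_eq_one_iff_of_nonzero' (⟨x, hx⟩ : U)
        (by simpa [Subtype.ext_iff] using hx0)).1 (by simpa using hd) ⟨y, hy⟩
      have : c • x = y := congrArg Subtype.val hc
      rw [← this]
      simp [hxx]
    simp [this]
  | succ k ih =>
    intro U hU hd
    obtain ⟨u, hu, hu0⟩ := exists_isotropic (U := U) hodd hB (by omega)
    obtain ⟨v, h⟩ := exists_hyperbolic_partner h2 hB hU hu hu0
    have hf := finrank_planeCompl hB h
    rw [ncard_isotropicVectors_of_hyperbolic h2 hB h,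
      ih _ (disjoint_orthogonal_planeCompl hB hU h) (by omega),
      show Module.finrank F (planeCompl B U u v) = 2 * k + 1 by omega]
    have : 0 < Nat.card F := Nat.card_pos
    obtain ⟨q, hq⟩ : ∃ q, Nat.card F = q + 1 := ⟨Nat.card F - 1, by omega⟩
    rw [hq, Nat.add_sub_cancel]
    ring

/-- Each nonzero isotropic vector has equally many partners. For `k = 0` the truncated exponent is
harmless, since the first factor is zero. -/
theorem ncard_hyperbolicPairs (hodd : Odd (Nat.card F)) (hB : B.IsSymm) (k : ℕ)
    (hU : Disjoint U (B.orthogonal U)) (hd : Module.finrank F U = 2 * k + 1) :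
    (hyperbolicPairs B U).ncard = (Nat.card F ^ (2 * k) - 1) * Nat.card F ^ (2 * k - 1) := by
  have h2 := two_ne_zero_of_odd_card hodd
  have h0 : (0 : V) ∈ isotropicVectors B U := ⟨U.zero_mem, by simp⟩
  rw [← ncard_isotropicVectors hodd hB k U hU hd, ← Set.ncard_sdiff_singleton_of_mem h0]
  rw [← mul_one (hyperbolicPairs B U).ncard]
  symm
  refine ncard_mul_eq_ncard_mul (fun (u : V) (p : V × V) => u = p.1) _ _ _ _ ?_ ?_
  · rintro u ⟨hu, hu0⟩
    obtain ⟨v, h⟩ := exists_hyperbolic_partner h2 hB hU hu hu0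
    have hf := finrank_planeCompl hB h
    rw [ncard_hyperbolicPairs_fst h2 hB h]
    congr 1
    omega
  · rintro ⟨u, v⟩ h
    rw [Set.ncard_eq_one]
    refine ⟨u, ?_⟩
    ext x
    simp only [Set.mem_ofPred_eq, Set.mem_singleton_iff]
    refine ⟨fun h => h.2, ?_⟩
    rintro rfl
    refine ⟨⟨⟨h.1.1, h.2.1⟩, ?_⟩, rfl⟩
    rintro rfl
    simpa using h.2.2.2

/-- Nonisotropic vectors are grouped by the line they span, `q - 1` to each nondegenerate line. -/
theorem ncard_nondegenerateSubspaces_one (hodd : Odd (Nat.card F)) (hB : B.IsSymm) (n : ℕ)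
    (hU : Disjoint U (B.orthogonal U)) (hd : Module.finrank F U = 2 * n + 1) :
    (nondegenerateSubspaces B U 1).ncard = Nat.card F ^ (2 * n) := by
  have key : (nondegenerateSubspaces B U 1).ncard * (Nat.card F - 1) =
      ((U : Set V) \ isotropicVectors B U).ncard * 1 := by
    refine ncard_mul_eq_ncard_mul (fun (W : Submodule F V) (x : V) => x ∈ (W : Set V) \ {0}) _ _ _ _ ?_ ?_
    · rintro W ⟨hWU, hW, hd⟩
      have h1 : Nat.card F - 1 = ((W : Set V) \ {0}).ncard := by
        rw [Set.ncard_sdiff_singleton_of_mem W.zero_mem, ncard_submodule, hd, pow_one]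
      rw [h1]
      congr 1
      ext x
      refine ⟨fun h => h.2, fun h => ⟨⟨hWU h.1, fun h' => h.2 ?_⟩, h⟩⟩
      have h3 := ncard_isotropicVectors hodd hB 0 W hW (by simpa using hd)
      rw [mul_zero, pow_zero, Set.ncard_eq_one] at h3
      obtain ⟨a, ha⟩ := h3
      have e0 : (0 : V) ∈ isotropicVectors B W := ⟨W.zero_mem, by simp⟩
      have ex : x ∈ isotropicVectors B W := ⟨h.1, h'.2⟩
      rw [ha] at e0 ex
      exact ex.trans e0.symm
    · rintro x ⟨hxU, hx⟩
      have hxx : B x x ≠ 0 := fun h => hx ⟨hxU, h⟩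
      have hx0 : x ≠ 0 := by rintro rfl; simp at hxx
      rw [Set.ncard_eq_one]
      refine ⟨Submodule.span F {x}, ?_⟩
      ext W
      simp only [Set.mem_ofPred_eq, Set.mem_singleton_iff]
      constructor
      · rintro ⟨⟨hWU, hW, hd⟩, hxW, -⟩
        symm
        refine Submodule.eq_of_le_of_finrank_eq ?_ ?_
        · rwa [Submodule.span_singleton_le_iff_mem]
        · rw [hd, finrank_span_singleton hx0]
      · rintro rfl
        refine ⟨⟨?_, ?_, finrank_span_singleton hx0⟩, Submodule.mem_span_singleton_self x, hx0⟩
        · rwa [Submodule.span_singleton_le_iff_mem]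
        · rw [disjoint_iff]; exact span_singleton_inf_orthogonal_eq_bot hxx
  have hsub : isotropicVectors B U ⊆ (U : Set V) := fun x h => h.1
  rw [mul_one, Set.ncard_sdiff hsub, ncard_isotropicVectors hodd hB n U hU hd, ncard_submodule,
    hd, pow_succ, ← Nat.mul_sub_one] at key
  exact Nat.eq_of_mul_eq_mul_right (by have := Finite.one_lt_card (α := F); omega) key

/-- Count pairs of a subspace `W` and a hyperbolic pair in `W`. With the pair fixed, `W` corresponds
to a nondegenerate subspace, two dimensions smaller, of the plane's complement. -/
theorem ncard_nondegenerateSubspaces_mul (hodd : Odd (Nat.card F)) (hB : B.IsSymm) (n k : ℕ)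
    (hU : Disjoint U (B.orthogonal U)) (hd : Module.finrank F U = 2 * n + 1) (c : ℕ)
    (hc : ∀ U' : Submodule F V, Disjoint U' (B.orthogonal U') →
      2 + Module.finrank F U' = 2 * n + 1 → (nondegenerateSubspaces B U' (2 * k + 1)).ncard = c) :
    (nondegenerateSubspaces B U (2 * (k + 1) + 1)).ncard *
        ((Nat.card F ^ (2 * (k + 1)) - 1) * Nat.card F ^ (2 * (k + 1) - 1)) =
      ((Nat.card F ^ (2 * n) - 1) * Nat.card F ^ (2 * n - 1)) * c := by
  rw [← ncard_hyperbolicPairs hodd hB n hU hd]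
  refine ncard_mul_eq_ncard_mul (fun W p => p ∈ hyperbolicPairs B W) _ _ _ _ ?_ ?_
  · rintro W ⟨hWU, hW, hd⟩
    rw [← ncard_hyperbolicPairs hodd hB (k + 1) hW hd]
    congr 1
    ext p
    exact ⟨fun h => h.2, fun h => ⟨⟨⟨hWU h.1.1, hWU h.1.2⟩, h.2⟩, h⟩⟩
  · rintro ⟨u, v⟩ h
    have hf := finrank_planeCompl hB h
    rw [← hc _ (disjoint_orthogonal_planeCompl hB hU h) (by omega),
      ← ncard_nondegenerateSubspaces_ge hB (disjoint_orthogonal_span_pair hB h) (span_pair_le h),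
      finrank_span_pair hB h]
    congr 1
    ext W
    rw [show 2 * (k + 1) + 1 = 2 + (2 * k + 1) by ring]
    refine and_congr_right fun hW => ?_
    rw [Submodule.span_le, Set.pair_subset_iff]
    exact ⟨fun h => h.1, fun h' => ⟨h', h.2⟩⟩

end Counting

/-! ### Involutions and their fixed spaces -/

section Involutions

variable {F V : Type*} [Field F] [AddCommGroup V] [Module F V]

/-- The fixed space of a linear automorphism. -/
def fixedSpace (g : V ≃ₗ[F] V) : Submodule F V :=
  LinearMap.eqLocus g.toLinearMap LinearMap.id

theorem mem_fixedSpace {g : V ≃ₗ[F] V} {x : V} : x ∈ fixedSpace g ↔ g x = x := Iff.rfl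

variable {B : LinearMap.BilinForm F V} {g : V ≃ₗ[F] V}

theorem apply_of_mem_orthogonal_fixedSpace
    (hV : ∀ x, (∀ y, B y x = 0) → x = 0) (hg : ∀ x y, B (g x) (g y) = B x y)
    (hgg : ∀ x, g (g x) = x) {x : V} (hx : x ∈ B.orthogonal (fixedSpace g)) : g x = -x := by
  have h : g x + x = 0 := by
    refine hV _ fun y => ?_
    -- Averaging over `g` makes any `y` fixed; orthogonality of `x` to the result says that `y` is
    -- orthogonal to `g x + x`.
    have hy : y + g y ∈ fixedSpace g := by rw [mem_fixedSpace, map_add, hgg, add_comm]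
    have h1 : B (y + g y) x = 0 := hx _ hy
    have h3 : B y (g x) = B (g y) x := by rw [← hg, hgg]
    simpa [h3, add_comm] using h1
  exact eq_neg_of_add_eq_zero_left h

theorem disjoint_orthogonal_fixedSpace (h2 : (2 : F) ≠ 0)
    (hV : ∀ x, (∀ y, B y x = 0) → x = 0) (hg : ∀ x y, B (g x) (g y) = B x y)
    (hgg : ∀ x, g (g x) = x) : Disjoint (fixedSpace g) (B.orthogonal (fixedSpace g)) := by
  rw [Submodule.disjoint_def]
  intro x hx hx'
  have h1 := apply_of_mem_orthogonal_fixedSpace hV hg hgg hx'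
  rw [mem_fixedSpace.1 hx] at h1
  have h3 : (2 : F) • x = 0 := by
    rw [two_smul]
    nth_rewrite 1 [h1]
    exact neg_add_cancel x
  exact (smul_eq_zero.1 h3).resolve_left h2

theorem exists_involution_fixedSpace_eq [FiniteDimensional F V] (h2 : (2 : F) ≠ 0)
    (hB : B.IsSymm) {W : Submodule F V} (hW : Disjoint W (B.orthogonal W)) :
    ∃ g : V ≃ₗ[F] V, (∀ x, B (g x) (g x) = B x x) ∧ (∀ x, g (g x) = x) ∧ fixedSpace g = W := by
  have hc := (isCompl_orthogonal_iff_disjoint hB.isRefl).2 hW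
  let f : V →ₗ[F] V := W.projection _ hc - (B.orthogonal W).projection _ hc.symm
  have hf : ∀ w ∈ W, ∀ z ∈ B.orthogonal W, f (w + z) = w - z := by
    intro w hw z hz
    have h1 : W.projection _ hc w = w := Submodule.projection_apply_left hc ⟨w, hw⟩
    have h3 : W.projection _ hc z = 0 := (Submodule.projection_apply_eq_zero_iff hc).2 hz
    have h4 : (B.orthogonal W).projection _ hc.symm z = z :=
      Submodule.projection_apply_left hc.symm ⟨z, hz⟩
    have h5 : (B.orthogonal W).projection _ hc.symm w = 0 :=
      (Submodule.projection_apply_eq_zero_iff hc.symm).2 hw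
    simp [f, h1, h3, h4, h5]
  have hdec : ∀ x, ∃ w ∈ W, ∃ z ∈ B.orthogonal W, w + z = x := fun x =>
    Submodule.mem_sup.1 (hc.sup_eq_top ▸ Submodule.mem_top)
  have hff : Function.Involutive f := by
    intro x
    obtain ⟨w, hw, z, hz, rfl⟩ := hdec x
    rw [hf w hw z hz, sub_eq_add_neg, hf w hw _ (neg_mem hz), sub_neg_eq_add]
  refine ⟨LinearEquiv.ofInvolutive f hff, fun x => ?_, hff, ?_⟩
  · obtain ⟨w, hw, z, hz, rfl⟩ := hdec x
    show B (f (w + z)) (f (w + z)) = _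
    have h1 : B w z = 0 := hz w hw
    have h3 : B z w = 0 := by rw [hB.eq, h1]
    simp [hf w hw z hz, h1, h3]
  · ext x
    rw [mem_fixedSpace]
    show f x = x ↔ _
    constructor
    · intro h
      obtain ⟨w, hw, z, hz, rfl⟩ := hdec x
      rw [hf w hw z hz] at h
      have h3 : (2 : F) • z = 0 := by
        rw [two_smul]
        have := congrArg (fun y => w + z - y) h
        simpa using this
      rw [(smul_eq_zero.1 h3).resolve_left h2, add_zero]
      exact hw
    · intro hx
      have := hf x hx 0 (Submodule.zero_mem _)
      simpa using this

theorem involutionCount_eq_ncard [FiniteDimensional F V] (h2 : (2 : F) ≠ 0)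
    (Q : QuadraticForm F V) (hQ : Q.Nondegenerate) :
    ∃ B : LinearMap.BilinForm F V, B.IsSymm ∧ B.Nondegenerate ∧
      involutionCount Q = {W : Submodule F V | Disjoint W (B.orthogonal W)}.ncard := by
  let _ := invertibleOfNonzero h2
  let B : LinearMap.BilinForm F V := QuadraticMap.associated Q
  have hsymm : B.IsSymm := ⟨fun x y => QuadraticMap.associated_isSymm F Q x y⟩
  have hnd : B.Nondegenerate := QuadraticMap.nondegenerate_associated_iff.2 hQ
  have hBQ : ∀ x, B x x = Q x := fun x => QuadraticMap.associated_eq_self_apply F Q x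
  have hV : ∀ x, (∀ y, B y x = 0) → x = 0 := hnd.2
  have hg : ∀ g ∈ quadraticOrthogonalGroup Q, ∀ x y, B (g x) (g y) = B x y := by
    intro g hg x y
    have hg' : ∀ x, Q (g x) = Q x := hg
    show QuadraticMap.associatedHom F Q _ _ = QuadraticMap.associatedHom F Q _ _
    rw [QuadraticMap.associated_apply, QuadraticMap.associated_apply, ← map_add, hg', hg', hg']
  have hgg : ∀ g : {g : quadraticOrthogonalGroup Q // g ^ 2 = 1}, ∀ x, g.1.1 (g.1.1 x) = x := by
    rintro ⟨g, hg⟩ x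
    rw [pow_two] at hg
    exact congrArg (fun f : quadraticOrthogonalGroup Q => f.1 x) hg
  refine ⟨B, hsymm, hnd, ?_⟩
  rw [← Nat.card_coe_set_eq]
  have hdisj : ∀ g : {g : quadraticOrthogonalGroup Q // g ^ 2 = 1},
      Disjoint (fixedSpace g.1.1) (B.orthogonal (fixedSpace g.1.1)) :=
    fun g => disjoint_orthogonal_fixedSpace h2 hV (hg _ g.1.2) (hgg g)
  refine Nat.card_eq_of_bijective (fun g => ⟨fixedSpace g.1.1, hdisj g⟩) ⟨?_, ?_⟩
  · intro g g' h
    have h' : fixedSpace g.1.1 = fixedSpace g'.1.1 := congrArg Subtype.val h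
    refine Subtype.ext (Subtype.ext (LinearEquiv.ext fun x => ?_))
    have hc := (isCompl_orthogonal_iff_disjoint hsymm.isRefl).2 (hdisj g)
    obtain ⟨w, hw, z, hz, rfl⟩ := Submodule.mem_sup.1
      (hc.sup_eq_top ▸ Submodule.mem_top : x ∈ fixedSpace g.1.1 ⊔ B.orthogonal (fixedSpace g.1.1))
    rw [map_add, map_add, apply_of_mem_orthogonal_fixedSpace hV (hg _ g.1.2) (hgg g) hz,
      mem_fixedSpace.1 hw]
    rw [h'] at hw hz
    rw [apply_of_mem_orthogonal_fixedSpace hV (hg _ g'.1.2) (hgg g') hz, mem_fixedSpace.1 hw]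
  · rintro ⟨W, hW⟩
    obtain ⟨g, h1, h3, h4⟩ := exists_involution_fixedSpace_eq h2 hsymm hW
    have h1' : ∀ x, Q (g x) = Q x := fun x => by rw [← hBQ, ← hBQ, h1]
    refine ⟨⟨⟨g, h1'⟩, ?_⟩, Subtype.ext h4⟩
    refine Subtype.ext (LinearEquiv.ext fun x => ?_)
    rw [pow_two]
    exact h3 x

end Involutions

/-! ### Summing over dimensions -/

section SumOverDimensions

variable {F V : Type*} [Field F] [AddCommGroup V] [Module F V] [Finite V]
  {B : LinearMap.BilinForm F V}

theorem ncard_disjoint_orthogonal_eq_sum (N : ℕ) (hd : Module.finrank F V < N) :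
    {W : Submodule F V | Disjoint W (B.orthogonal W)}.ncard =
      ∑ d ∈ Finset.range N, (nondegenerateSubspaces B ⊤ d).ncard := by
  classical
  have := Fintype.ofFinite (Submodule F V)
  rw [Set.ncard_eq_toFinset_card', Finset.card_eq_sum_card_fiberwise
    (f := fun W : Submodule F V => Module.finrank F W) (t := Finset.range N)]
  · refine Finset.sum_congr rfl fun d _ => ?_
    rw [← Set.ncard_coe_finset]
    congr 1
    ext W
    simp [nondegenerateSubspaces]
  · intro W _
    have := Submodule.finrank_le W
    simp only [Finset.coe_range, Set.mem_Iio]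
    omega

theorem ncard_nondegenerateSubspaces_compl (hB : B.IsSymm) (hnd : B.Nondegenerate) {d e : ℕ}
    (hde : d + e = Module.finrank F V) :
    (nondegenerateSubspaces B ⊤ d).ncard = (nondegenerateSubspaces B ⊤ e).ncard := by
  have key : ∀ {d e : ℕ}, d + e = Module.finrank F V →
      Set.MapsTo B.orthogonal (nondegenerateSubspaces B ⊤ d) (nondegenerateSubspaces B ⊤ e) := by
    rintro d e hde W ⟨-, hW, hd⟩
    refine ⟨le_top, ?_, ?_⟩
    · rw [orthogonal_orthogonal hnd hB.isRefl]
      exact hW.symm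
    · rw [finrank_orthogonal hnd]
      omega
  exact Set.BijOn.ncard_eq (f := B.orthogonal) (Set.InvOn.bijOn (f' := B.orthogonal)
    ⟨fun W _ => orthogonal_orthogonal hnd hB.isRefl W,
      fun W _ => orthogonal_orthogonal hnd hB.isRefl W⟩ (key hde) (key (by omega)))

theorem ncard_disjoint_orthogonal_eq_two_mul_sum (hB : B.IsSymm) (hnd : B.Nondegenerate) (n : ℕ)
    (hd : Module.finrank F V = 2 * n + 1) :
    {W : Submodule F V | Disjoint W (B.orthogonal W)}.ncard =
      2 * ∑ k ∈ Finset.range (n + 1), (nondegenerateSubspaces B ⊤ (2 * k + 1)).ncard := by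
  have hsplit : ∀ (f : ℕ → ℕ) (m : ℕ), ∑ d ∈ Finset.range (2 * m), f d =
      ∑ k ∈ Finset.range m, f (2 * k) + ∑ k ∈ Finset.range m, f (2 * k + 1) := by
    intro f m
    induction m with
    | zero => simp
    | succ m ih =>
      rw [show 2 * (m + 1) = 2 * m + 1 + 1 by ring, Finset.sum_range_succ, Finset.sum_range_succ,
        ih, Finset.sum_range_succ, Finset.sum_range_succ]
      ring
  rw [ncard_disjoint_orthogonal_eq_sum (2 * (n + 1)) (by omega), hsplit, two_mul]
  congr 1
  -- Reversal matches dimension `2(n - k)` with `2k + 1`, which add up to `2n + 1`.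
  rw [← Finset.sum_range_reflect]
  refine Finset.sum_congr rfl fun k hk => ncard_nondegenerateSubspaces_compl hB hnd ?_
  rw [Finset.mem_range] at hk
  omega

end SumOverDimensions

/-! ### Gaussian binomials, theta sums and the limit -/

section QSeries

/-- The `q`-Pochhammer product `(1 - x) (1 - x ^ 2) ⋯ (1 - x ^ n)`. -/
noncomputable def qPoch (x : ℝ) (n : ℕ) : ℝ := ∏ i ∈ Finset.range n, (1 - x ^ (i + 1))

theorem qPoch_zero (x : ℝ) : qPoch x 0 = 1 := by simp [qPoch]

theorem qPoch_succ (x : ℝ) (n : ℕ) : qPoch x (n + 1) = qPoch x n * (1 - x ^ (n + 1)) :=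
  Finset.prod_range_succ _ _

variable {x : ℝ}

theorem half_le_qPoch (h0 : 0 ≤ x) (h1 : x ≤ 1 / 3) (n : ℕ) : 1 / 2 ≤ qPoch x n := by
  -- The strengthened bound is an equality at `n = 0`; its induction step needs `1 - 2x - x * x ^ n
  -- ≥ 0`, which `x ≤ 1/3` ensures.
  suffices h : (1 + x ^ n) / 2 ≤ qPoch x n by
    have := pow_nonneg h0 n
    linarith
  induction n with
  | zero => simp [qPoch_zero]
  | succ n ih =>
    have hy := pow_nonneg h0 n
    have hy1 : x ^ n ≤ 1 := pow_le_one₀ h0 (by linarith)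
    have hz1 : x ^ (n + 1) ≤ 1 := pow_le_one₀ h0 (by linarith)
    rw [qPoch_succ]
    refine le_trans ?_ (mul_le_mul_of_nonneg_right ih (sub_nonneg.2 hz1))
    rw [pow_succ]
    have h3 : 0 ≤ x ^ n * (1 - 2 * x - x * x ^ n) := by
      refine mul_nonneg hy ?_
      have := mul_le_mul_of_nonneg_left hy1 h0
      linarith
    nlinarith

theorem qPoch_pos (h0 : 0 ≤ x) (h1 : x ≤ 1 / 3) (n : ℕ) : 0 < qPoch x n :=
  lt_of_lt_of_le (by norm_num) (half_le_qPoch h0 h1 n)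

theorem qPoch_antitone (h0 : 0 ≤ x) (h1 : x ≤ 1 / 3) : Antitone (qPoch x) := by
  refine antitone_nat_of_succ_le fun n => ?_
  rw [qPoch_succ]
  have := pow_nonneg h0 (n + 1)
  exact mul_le_of_le_one_right (qPoch_pos h0 h1 n).le (by linarith)

theorem qPoch_le_one (h0 : 0 ≤ x) (h1 : x ≤ 1 / 3) (n : ℕ) : qPoch x n ≤ 1 := by
  rw [← qPoch_zero x]
  exact qPoch_antitone h0 h1 n.zero_le

theorem exists_tendsto_qPoch (h0 : 0 ≤ x) (h1 : x ≤ 1 / 3) :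
    ∃ L : ℝ, L ≠ 0 ∧ Tendsto (qPoch x) atTop (𝓝 L) := by
  have h := tendsto_atTop_ciInf (qPoch_antitone h0 h1)
    ⟨1 / 2, by rintro _ ⟨n, rfl⟩; exact half_le_qPoch h0 h1 n⟩
  refine ⟨_, ?_, h⟩
  have : (1 : ℝ) / 2 ≤ _ := ge_of_tendsto' h (half_le_qPoch h0 h1)
  intro h'
  rw [h'] at this
  norm_num at this

/-- The Gaussian binomial coefficient of `a + b` over `a` at `x`, extended by zero to negative
`a` or `b`. -/
noncomputable def qBinom (x : ℝ) (a b : ℤ) : ℝ :=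
  if 0 ≤ a ∧ 0 ≤ b then qPoch x (a.toNat + b.toNat) / (qPoch x a.toNat * qPoch x b.toNat) else 0

theorem qBinom_natCast (x : ℝ) (a b : ℕ) :
    qBinom x a b = qPoch x (a + b) / (qPoch x a * qPoch x b) := by
  simp [qBinom]

theorem abs_qBinom_le (h0 : 0 ≤ x) (h1 : x ≤ 1 / 3) (a b : ℤ) : |qBinom x a b| ≤ 4 := by
  unfold qBinom
  split_ifs
  · have ha := half_le_qPoch h0 h1 a.toNat
    have hb := half_le_qPoch h0 h1 b.toNat
    have hab := qPoch_pos h0 h1 (a.toNat + b.toNat)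
    have hab1 := qPoch_le_one h0 h1 (a.toNat + b.toNat)
    rw [abs_of_nonneg (by positivity), div_le_iff₀ (by positivity)]
    nlinarith
  · norm_num

theorem tendsto_qBinom {L : ℝ} (hL : L ≠ 0) (h : Tendsto (qPoch x) atTop (𝓝 L)) {a b : ℕ → ℤ}
    (ha : Tendsto a atTop atTop) (hb : Tendsto b atTop atTop) :
    Tendsto (fun N => qBinom x (a N) (b N)) atTop (𝓝 L⁻¹) := by
  have ht : Tendsto Int.toNat atTop atTop :=
    tendsto_atTop.2 fun n => (eventually_ge_atTop (n : ℤ)).mono fun m hm => by omega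
  have ha' := ht.comp ha
  have hb' := ht.comp hb
  have hlim := (h.comp (ha'.atTop_add_atTop hb')).div ((h.comp ha').mul (h.comp hb'))
    (mul_ne_zero hL hL)
  rw [show L / (L * L) = L⁻¹ by field_simp] at hlim
  refine hlim.congr' ?_
  filter_upwards [ha.eventually_ge_atTop 0, hb.eventually_ge_atTop 0] with N h1 h2
  simp [qBinom, h1, h2]

/-- Extension by zero turns sums of growing length into series over the fixed index set `ℤ`, as
dominated convergence requires. -/
theorem tsum_qBinom (x : ℝ) (g : ℤ → ℝ) (c : ℤ) (n : ℕ) :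
    ∑' j : ℤ, qBinom x (c - j) (n - c + j) * g j =
      ∑ k ∈ Finset.range (n + 1), qBinom x k (n - k) * g (c - k) := by
  rw [← (Equiv.subLeft c).tsum_eq]
  simp only [Equiv.subLeft_apply, sub_sub_cancel]
  rw [tsum_eq_sum (s := (Finset.range (n + 1)).map Nat.castEmbedding)]
  · rw [Finset.sum_map]
    refine Finset.sum_congr rfl fun k _ => ?_
    simp
  · intro k hk
    rw [qBinom, if_neg, zero_mul]
    rintro ⟨h1, h2⟩
    apply hk
    rw [Finset.mem_map]
    refine ⟨k.toNat, ?_, ?_⟩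
    · rw [Finset.mem_range]; omega
    · simpa using h1

theorem tendsto_sum_qBinom (h0 : 0 ≤ x) (h1 : x ≤ 1 / 3) {L : ℝ} (hL : L ≠ 0)
    (h : Tendsto (qPoch x) atTop (𝓝 L)) {g : ℤ → ℝ} (hg : Summable g) (e : ℕ) :
    Tendsto (fun N : ℕ => ∑ k ∈ Finset.range (2 * N + e + 1),
      qBinom x k ((2 * N + e : ℕ) - k) * g (N - k)) atTop (𝓝 (L⁻¹ * ∑' j, g j)) := by
  simp_rw [← tsum_qBinom, ← tsum_mul_left]
  refine tendsto_tsum_of_dominated_convergence (bound := fun j => 4 * |g j|)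
    (hg.abs.mul_left 4) (fun j => ?_) (Eventually.of_forall fun N j => ?_)
  · refine (tendsto_qBinom hL h ?_ ?_).mul_const _
    · exact tendsto_atTop_add_const_right _ _ tendsto_natCast_atTop_atTop
    · refine tendsto_atTop_mono (f := fun N : ℕ => (N : ℤ) + j) (fun N => ?_)
        (tendsto_atTop_add_const_right _ _ tendsto_natCast_atTop_atTop)
      push_cast
      linarith
  · rw [Real.norm_eq_abs, abs_mul]
    exact mul_le_mul_of_nonneg_right (abs_qBinom_le h0 h1 _ _) (abs_nonneg _)

/-- The Gaussian binomial coefficients, by their Pascal recursion. -/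
noncomputable def gaussBinom (x : ℝ) : ℕ → ℕ → ℝ
  | _, 0 => 1
  | 0, _ + 1 => 0
  | n + 1, k + 1 => gaussBinom x n (k + 1) + x ^ (n - k) * gaussBinom x n k

theorem gaussBinom_of_lt (x : ℝ) : ∀ n k : ℕ, n < k → gaussBinom x n k = 0
  | 0, k + 1, _ => by simp [gaussBinom]
  | n + 1, k + 1, h => by
    rw [gaussBinom, gaussBinom_of_lt x n (k + 1) (by omega), gaussBinom_of_lt x n k (by omega)]
    simp

theorem gaussBinom_mul (x : ℝ) : ∀ n k : ℕ, k ≤ n →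
    gaussBinom x n k * (qPoch x k * qPoch x (n - k)) = qPoch x n
  | n, 0, _ => by simp [gaussBinom, qPoch_zero]
  | n + 1, k + 1, h => by
    have ih1 := gaussBinom_mul x n k (by omega)
    rw [gaussBinom, Nat.add_sub_add_right]
    rcases Nat.lt_or_ge k n with hk | hk
    · have ih2 := gaussBinom_mul x n (k + 1) (by omega)
      obtain ⟨j, rfl⟩ : ∃ j, n = k + 1 + j := ⟨n - (k + 1), by omega⟩
      rw [show k + 1 + j - k = j + 1 by omega] at ih1 ⊢
      rw [Nat.add_sub_cancel_left] at ih2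
      rw [qPoch_succ x (k + 1 + j)]
      calc _ = (1 - x ^ (j + 1)) *
            (gaussBinom x (k + 1 + j) (k + 1) * (qPoch x (k + 1) * qPoch x j)) +
          x ^ (j + 1) * (1 - x ^ (k + 1)) *
            (gaussBinom x (k + 1 + j) k * (qPoch x k * qPoch x (j + 1))) := by
              rw [qPoch_succ x j, qPoch_succ x k]; ring
        _ = _ := by rw [ih1, ih2]; ring
    · obtain rfl : k = n := by omega
      rw [gaussBinom_of_lt x k (k + 1) (by omega), qPoch_succ x k]
      rw [Nat.sub_self] at ih1 ⊢
      linear_combination (1 - x ^ (k + 1)) * ih1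

theorem gaussBinom_eq_qBinom (h0 : 0 ≤ x) (h1 : x ≤ 1 / 3) {n k : ℕ} (h : k ≤ n) :
    gaussBinom x n k = qBinom x k (n - k) := by
  have hk := qPoch_pos h0 h1 k
  have hnk := qPoch_pos h0 h1 (n - k)
  rw [← Nat.cast_sub h, qBinom_natCast, Nat.add_sub_cancel' h, eq_div_iff (by positivity)]
  exact gaussBinom_mul x n k h

/-- The `q`-binomial theorem. -/
theorem prod_one_add_mul_pow (t z : ℝ) (n : ℕ) :
    ∏ i ∈ Finset.range n, (1 + z * (t ^ 2) ^ i) =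
      ∑ k ∈ Finset.range (n + 1), gaussBinom (t ^ 2) n k * t ^ (k * (k - 1)) * z ^ k := by
  induction n with
  | zero => simp [gaussBinom]
  | succ n ih =>
    rw [Finset.prod_range_succ, ih, mul_add, mul_one]
    nth_rewrite 1 [Finset.sum_range_succ']
    rw [Finset.sum_range_succ' _ (n + 1)]
    have hlast : ∑ k ∈ Finset.range n, gaussBinom (t ^ 2) n (k + 1) * t ^ ((k + 1) * (k + 1 - 1)) *
        z ^ (k + 1) = ∑ k ∈ Finset.range (n + 1), gaussBinom (t ^ 2) n (k + 1) *
          t ^ ((k + 1) * (k + 1 - 1)) * z ^ (k + 1) := by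
      rw [Finset.sum_range_succ, gaussBinom_of_lt _ n (n + 1) (by omega)]
      simp
    rw [hlast, Finset.sum_mul, add_right_comm, ← Finset.sum_add_distrib]
    congr 1
    · refine Finset.sum_congr rfl fun k hk => ?_
      obtain ⟨j, rfl⟩ : ∃ j, n = k + j := ⟨n - k, by have := Finset.mem_range.1 hk; omega⟩
      rw [gaussBinom, Nat.add_sub_cancel_left, Nat.add_sub_cancel]
      have : (k + 1) * k = k * (k - 1) + 2 * k := by
        cases k with
        | zero => rfl
        | succ k => rw [Nat.add_sub_cancel]; ring
      rw [this]
      ring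
    · simp [gaussBinom]

/-- A finite triple product: the `q`-binomial theorem with `2M + 1` factors at `z = x ^ (-M)`, `x =
t ^ 2`. The middle factor is 2, the upper `M` give `∏ (1 + x ^ i)`, and the lower `M` give the same
once `t ^ (M(M+1))` clears their negative powers. -/
theorem two_mul_prod_one_add_sq {t : ℝ} (h0 : 0 < t) (h1 : t ^ 2 ≤ 1 / 3) (M : ℕ) :
    2 * ∏ i ∈ Finset.range M, (1 + (t ^ 2) ^ (i + 1)) ^ 2 =
      ∑ k ∈ Finset.range (2 * M + 1 + 1), qBinom (t ^ 2) k ((2 * M + 1 : ℕ) - k) *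
        t ^ (((M : ℤ) - k) * (M - k + 1)) := by
  have hx : (0 : ℝ) < t ^ 2 := by positivity
  have hb := prod_one_add_mul_pow t ((t ^ 2) ^ M)⁻¹ (2 * M + 1)
  have hw : ∏ i ∈ Finset.range M, (t ^ 2) ^ (i + 1) = t ^ (M * (M + 1)) := by
    induction M with
    | zero => simp
    | succ M ih =>
      rw [Finset.prod_range_succ, ih (prod_one_add_mul_pow t _ _)]
      ring
  have hl : (t ^ (M * (M + 1))) * ∏ i ∈ Finset.range (2 * M + 1),
      (1 + ((t ^ 2) ^ M)⁻¹ * (t ^ 2) ^ i) =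
        2 * ∏ i ∈ Finset.range M, (1 + (t ^ 2) ^ (i + 1)) ^ 2 := by
    rw [show 2 * M + 1 = M + (M + 1) by ring, Finset.prod_range_add, Finset.prod_range_succ',
      ← hw, ← Finset.prod_range_reflect (fun i => 1 + ((t ^ 2) ^ M)⁻¹ * (t ^ 2) ^ i) M,
      Finset.prod_pow, pow_two (∏ i ∈ Finset.range M, _)]
    have e1 : ∏ j ∈ Finset.range M, (1 + ((t ^ 2) ^ M)⁻¹ * (t ^ 2) ^ (M + (j + 1))) =
        ∏ j ∈ Finset.range M, (1 + (t ^ 2) ^ (j + 1)) := by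
      refine Finset.prod_congr rfl fun j _ => ?_
      rw [pow_add, inv_mul_cancel_left₀ (by positivity)]
    have e2 : (∏ i ∈ Finset.range M, (t ^ 2) ^ (i + 1)) *
        ∏ j ∈ Finset.range M, (1 + ((t ^ 2) ^ M)⁻¹ * (t ^ 2) ^ (M - 1 - j)) =
          ∏ j ∈ Finset.range M, (1 + (t ^ 2) ^ (j + 1)) := by
      rw [← Finset.prod_mul_distrib]
      refine Finset.prod_congr rfl fun j hj => ?_
      have : (t ^ 2) ^ M = (t ^ 2) ^ (j + 1) * (t ^ 2) ^ (M - 1 - j) := by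
        rw [← pow_add]; congr 1; have := Finset.mem_range.1 hj; omega
      rw [this]
      field_simp
      ring
    have e3 : 1 + ((t ^ 2) ^ M)⁻¹ * (t ^ 2) ^ (M + 0) = 2 := by
      rw [add_zero, inv_mul_cancel₀ (by positivity)]; norm_num
    rw [e1, e3, ← mul_assoc, e2]
    ring
  rw [← hl, hb, Finset.mul_sum]
  refine Finset.sum_congr rfl fun k hk => ?_
  rw [gaussBinom_eq_qBinom hx.le h1 (by have := Finset.mem_range.1 hk; omega)]
  have : t ^ (((M : ℤ) - k) * (M - k + 1)) =
      t ^ (M * (M + 1)) * t ^ (k * (k - 1)) * (((t ^ 2) ^ M)⁻¹) ^ k := by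
    have hk1 : (k * (k - 1) : ℕ) = (k : ℤ) * (k - 1) := by
      cases k with
      | zero => simp
      | succ k => push_cast; simp
    rw [← zpow_natCast t (M * (M + 1)), ← zpow_natCast t (k * (k - 1)), ← pow_mul, inv_pow,
      ← pow_mul, ← zpow_natCast t (2 * M * k), ← zpow_neg, ← zpow_add₀ h0.ne', ← zpow_add₀ h0.ne',
      hk1]
    congr 1
    push_cast
    ring
  rw [this]
  ring

theorem summable_zpow_theta {t : ℝ} (h0 : 0 < t) (h1 : t < 1) :
    Summable fun j : ℤ => t ^ ((2 * j) * (2 * j + 1)) := by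
  have hs : Summable fun j : ℤ => t ^ j.natAbs := by
    have h := summable_geometric_of_lt_one h0.le h1
    exact Summable.of_nat_of_neg (by simpa using h) (by simpa using h)
  refine Summable.of_nonneg_of_le (fun j => (zpow_pos h0 _).le) (fun j => ?_) hs
  rw [← zpow_natCast]
  refine zpow_le_zpow_right_of_le_one₀ h0 h1.le ?_
  rw [Int.natCast_natAbs]
  rcases abs_cases j with ⟨h, hj⟩ | ⟨h, hj⟩ <;> rw [h] <;> nlinarith

theorem hasSum_int_even_add_odd {f : ℤ → ℝ} {a b : ℝ} (he : HasSum (fun k => f (2 * k)) a)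
    (ho : HasSum (fun k => f (2 * k + 1)) b) : HasSum f (a + b) := by
  have := mul_right_injective₀ (two_ne_zero' ℤ)
  replace ho := ((add_left_injective 1).comp this).hasSum_range_iff.2 ho
  refine (this.hasSum_range_iff.2 he).add_isCompl ?_ ho
  simpa [Function.comp_def] using Int.isCompl_even_odd

theorem hasSum_theta {t : ℝ} (h0 : 0 < t) (h1 : t < 1) : ∃ T : ℝ,
    HasSum (fun j : ℤ => t ^ ((2 * j) * (2 * j + 1))) T ∧
    HasSum (fun j : ℤ => t ^ ((2 * j) * (2 * j - 1))) T ∧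
    HasSum (fun j : ℤ => t ^ (j * (j + 1))) (2 * T) := by
  obtain ⟨T, hT⟩ := summable_zpow_theta h0 h1
  have hT' : HasSum (fun j : ℤ => t ^ ((2 * j) * (2 * j - 1))) T := by
    rw [← (Equiv.neg ℤ).hasSum_iff] at hT
    refine hT.congr_fun ?_
    intro j
    simp only [Function.comp, Equiv.neg_apply]
    congr 1
    ring
  refine ⟨T, hT, hT', ?_⟩
  rw [two_mul]
  -- The odd-index terms are the second series shifted by one.
  refine hasSum_int_even_add_odd hT ?_
  rw [← (Equiv.addRight (1 : ℤ)).hasSum_iff] at hT'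
  refine hT'.congr_fun ?_
  intro j
  simp only [Function.comp, Equiv.coe_addRight]
  congr 1
  ring

theorem tendsto_of_tendsto_even_odd {u : ℕ → ℝ} {l : ℝ}
    (h0 : Tendsto (fun n => u (2 * n)) atTop (𝓝 l))
    (h1 : Tendsto (fun n => u (2 * n + 1)) atTop (𝓝 l)) : Tendsto u atTop (𝓝 l) := by
  rw [Metric.tendsto_atTop] at *
  intro ε hε
  obtain ⟨a, ha⟩ := h0 ε hε
  obtain ⟨b, hb⟩ := h1 ε hε
  refine ⟨2 * (a + b) + 1, fun n hn => ?_⟩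
  rcases Nat.even_or_odd' n with ⟨m, rfl | rfl⟩
  · exact ha m (by omega)
  · exact hb m (by omega)

theorem multipliable_one_add_pow_sq (h0 : 0 ≤ x) (h1 : x < 1) :
    Multipliable fun i : ℕ => (1 + x ^ (i + 1)) ^ 2 := by
  have h : Multipliable fun i : ℕ => 1 + x ^ (i + 1) :=
    Real.multipliable_one_add_of_summable
      ((summable_nat_add_iff 1).2 (summable_geometric_of_lt_one h0 h1))
  simp_rw [pow_two]
  exact h.mul h

theorem tendsto_sum_qBinom_theta {t : ℝ} (h0 : 0 < t) (h1 : t ^ 2 ≤ 1 / 3) :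
    Tendsto (fun n : ℕ => ∑ k ∈ Finset.range (n + 1), qBinom (t ^ 2) k (n - k) *
      t ^ (((n : ℤ) - 2 * k) * (n - 2 * k - 1))) atTop
      (𝓝 (∏' i : ℕ, (1 + (t ^ 2) ^ (i + 1)) ^ 2)) := by
  have ht1 : t < 1 := by nlinarith
  have hx : (0 : ℝ) ≤ t ^ 2 := by positivity
  obtain ⟨L, hL, hlim⟩ := exists_tendsto_qPoch hx h1
  obtain ⟨T, hT, hT', hTT⟩ := hasSum_theta h0 ht1
  have hprod : ∏' i : ℕ, (1 + (t ^ 2) ^ (i + 1)) ^ 2 = L⁻¹ * T := by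
    have hm := (multipliable_one_add_pow_sq hx (by linarith)).hasProd.tendsto_prod_nat
    have h3 := tendsto_sum_qBinom hx h1 hL hlim hTT.summable 1
    simp_rw [← two_mul_prod_one_add_sq h0 h1, hTT.tsum_eq] at h3
    have := tendsto_nhds_unique (hm.const_mul 2) h3
    linarith
  rw [hprod]
  refine tendsto_of_tendsto_even_odd ?_ ?_
  -- For `n = 2N` put `j = N - k`: then `n - 2k = 2j`. For odd `n` it is `2j + 1`, giving the other
  -- theta series.
  · have h3 := tendsto_sum_qBinom hx h1 hL hlim hT'.summable 0
    rw [hT'.tsum_eq] at h3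
    refine h3.congr fun N => Finset.sum_congr rfl fun k _ => ?_
    congr 2
    push_cast
    ring
  · have h3 := tendsto_sum_qBinom hx h1 hL hlim hT.summable 1
    rw [hT.tsum_eq] at h3
    refine h3.congr fun N => Finset.sum_congr rfl fun k _ => ?_
    congr 2
    push_cast
    ring

end QSeries

/-! ### The closed formula and the normalised count -/

section ClosedFormula

variable {F V : Type*} [Field F] [AddCommGroup V] [Module F V] [Finite V] [Finite F]
  {B : LinearMap.BilinForm F V}

/-- Induction on `k` with the codimension `2j` fixed: passing to the complement of a hyperbolic
plane lowers `k` and keeps `j`. -/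
theorem ncard_nondegenerateSubspaces_eq (hodd : Odd (Nat.card F)) (hB : B.IsSymm) {t : ℝ}
    (ht : t * Nat.card F = 1) (h1 : t ^ 2 ≤ 1 / 3) (k j : ℕ) :
    ∀ U : Submodule F V, Disjoint U (B.orthogonal U) → Module.finrank F U = 2 * (k + j) + 1 →
      ((nondegenerateSubspaces B U (2 * k + 1)).ncard : ℝ) =
        (Nat.card F : ℝ) ^ (2 * j * (2 * k + 1)) * qBinom (t ^ 2) k j := by
  have hx := sq_nonneg t
  have htq : ∀ m, (t ^ 2) ^ m * (Nat.card F : ℝ) ^ (2 * m) = 1 := fun m => by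
    rw [← pow_mul, ← mul_pow, ht, one_pow]
  have hq0 : (0 : ℝ) < Nat.card F := Nat.cast_pos.2 Nat.card_pos
  have hq1 : (1 : ℝ) < Nat.card F := by exact_mod_cast Finite.one_lt_card (α := F)
  induction k with
  | zero =>
    intro U hU hd
    have hj := (qPoch_pos hx h1 j).ne'
    rw [mul_zero, zero_add, ncard_nondegenerateSubspaces_one hodd hB j hU (by omega),
      qBinom_natCast, qPoch_zero, zero_add, one_mul, div_self hj]
    push_cast
    ring
  | succ k ih =>
    intro U hU hd
    obtain ⟨u, hu, hu0⟩ := exists_isotropic (U := U) hodd hB (by omega)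
    obtain ⟨v, huv⟩ := exists_hyperbolic_partner (two_ne_zero_of_odd_card hodd) hB hU hu hu0
    have hf := finrank_planeCompl hB huv
    have hU' := ih _ (disjoint_orthogonal_planeCompl hB hU huv) (by omega)
    have key := ncard_nondegenerateSubspaces_mul hodd hB (k + 1 + j) k hU hd
      (nondegenerateSubspaces B (planeCompl B U u v) (2 * k + 1)).ncard (fun U' h h' => by
        have := ih U' h (by omega)
        rw [← hU'] at this
        exact_mod_cast this)
    have hpos : ∀ m : ℕ, 1 ≤ Nat.card F ^ m := fun m => Nat.one_le_pow _ _ Nat.card_pos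
    have key' := congrArg (Nat.cast : ℕ → ℝ) key
    rw [Nat.cast_mul, Nat.cast_mul, Nat.cast_mul, Nat.cast_mul, Nat.cast_sub (hpos _),
      Nat.cast_sub (hpos _), hU', qBinom_natCast, show 2 * (k + 1) - 1 = 2 * k + 1 by omega,
      show 2 * (k + 1 + j) - 1 = 2 * (k + j) + 1 by omega] at key'
    push_cast at key'
    rw [qBinom_natCast]
    have hk := (qPoch_pos hx h1 k).ne'
    have hj := (qPoch_pos hx h1 j).ne'
    have hk1 := (qPoch_pos hx h1 (k + 1)).ne'
    have e1 : (Nat.card F : ℝ) ^ (2 * (k + 1)) - 1 =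
        (Nat.card F : ℝ) ^ (2 * (k + 1)) * (1 - (t ^ 2) ^ (k + 1)) := by
      linear_combination htq (k + 1)
    have e2 : (Nat.card F : ℝ) ^ (2 * (k + 1 + j)) - 1 =
        (Nat.card F : ℝ) ^ (2 * (k + 1 + j)) * (1 - (t ^ 2) ^ (k + j + 1)) := by
      have := htq (k + 1 + j)
      rw [show k + j + 1 = k + 1 + j by ring]
      linear_combination this
    have hne : ((Nat.card F : ℝ) ^ (2 * (k + 1)) - 1) * (Nat.card F : ℝ) ^ (2 * k + 1) ≠ 0 := by
      refine mul_ne_zero (sub_ne_zero.2 ?_) (pow_ne_zero _ hq0.ne')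
      exact (one_lt_pow₀ hq1 (by omega)).ne'
    refine mul_right_cancel₀ hne (key'.trans ?_)
    rw [qPoch_succ] at hk1
    have hk2 := right_ne_zero_of_mul hk1
    rw [e1, e2, show k + 1 + j = k + j + 1 by ring, qPoch_succ, qPoch_succ]
    field_simp
    ring

end ClosedFormula

theorem involutionCount_div_eq {F V : Type*} [Field F] [AddCommGroup V] [Module F V] [Finite F]
    [Finite V] (hodd : Odd (Nat.card F)) (Q : QuadraticForm F V) (hQ : Q.Nondegenerate) (n : ℕ)
    (hd : Module.finrank F V = 2 * n + 1) {t : ℝ} (h0 : 0 < t) (ht : t * Nat.card F = 1)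
    (h1 : t ^ 2 ≤ 1 / 3) :
    (involutionCount Q : ℝ) / (Nat.card F : ℝ) ^ (n ^ 2 + n) =
      2 * ∑ k ∈ Finset.range (n + 1), qBinom (t ^ 2) k (n - k) *
        t ^ (((n : ℤ) - 2 * k) * (n - 2 * k - 1)) := by
  obtain ⟨B, hB, hnd, hcount⟩ := involutionCount_eq_ncard (two_ne_zero_of_odd_card hodd) Q hQ
  have hU : Disjoint (⊤ : Submodule F V) (B.orthogonal ⊤) := by
    rw [LinearMap.BilinForm.orthogonal_top_eq_bot hnd]
    exact disjoint_bot_right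
  rw [hcount, ncard_disjoint_orthogonal_eq_two_mul_sum hB hnd n hd]
  push_cast
  rw [mul_div_assoc, Finset.sum_div]
  congr 1
  refine Finset.sum_congr rfl fun k hk => ?_
  obtain ⟨j, rfl⟩ : ∃ j, n = k + j := ⟨n - k, by have := Finset.mem_range.1 hk; omega⟩
  rw [ncard_nondegenerateSubspaces_eq hodd hB ht h1 k j ⊤ hU (by rw [finrank_top, hd])]
  have hq : (Nat.card F : ℝ) = t⁻¹ := eq_inv_of_mul_eq_one_right ht
  rw [show ((k + j : ℕ) : ℤ) - k = j by push_cast; ring, mul_comm (_ ^ _), mul_div_assoc]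
  congr 1
  rw [hq, ← zpow_natCast, ← zpow_natCast, inv_zpow', inv_zpow', ← zpow_sub₀ h0.ne']
  congr 1
  push_cast
  ring

end OrthogonalInvolutions

theorem mainTheorem9 {F : Type*} [Field F] [Finite F] (q : ℕ) (hq : Nat.card F = q)
    (hodd : Odd q)
    (Q : ∀ n : ℕ, QuadraticForm F (Fin (2 * n + 1) → F)) (hQ : ∀ n, (Q n).Nondegenerate) :
    Multipliable (fun i : ℕ => (1 + 1 / (q : ℝ) ^ (2 * (i + 1))) ^ 2) ∧
      Tendsto (fun n : ℕ => (involutionCount (Q n) : ℝ) / (q : ℝ) ^ (n ^ 2 + n)) atTop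
        (𝓝 (2 * ∏' i : ℕ, (1 + 1 / (q : ℝ) ^ (2 * (i + 1))) ^ 2)) := by
  subst hq
  have hq3 : 3 ≤ Nat.card F := by
    have := Finite.one_lt_card (α := F)
    have := Nat.odd_iff.1 hodd
    omega
  have hq3' : (3 : ℝ) ≤ Nat.card F := by exact_mod_cast hq3
  have hq0 : (0 : ℝ) < Nat.card F := by linarith
  set t : ℝ := (Nat.card F : ℝ)⁻¹ with ht
  have h0 : 0 < t := inv_pos.2 hq0
  have h3 : t ≤ 1 / 3 := by
    rw [ht, one_div]
    exact inv_anti₀ (by norm_num) hq3'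
  have h1 : t ^ 2 ≤ 1 / 3 := by nlinarith
  have hrw : ∀ i : ℕ, 1 / (Nat.card F : ℝ) ^ (2 * (i + 1)) = (t ^ 2) ^ (i + 1) := fun i => by
    rw [ht, ← pow_mul, inv_pow, one_div]
  simp_rw [hrw]
  refine ⟨OrthogonalInvolutions.multipliable_one_add_pow_sq (sq_nonneg t) (by linarith), ?_⟩
  refine ((OrthogonalInvolutions.tendsto_sum_qBinom_theta h0 h1).const_mul 2).congr fun n => ?_
  rw [← OrthogonalInvolutions.involutionCount_div_eq hodd (Q n) (hQ n) n
    (by simp) h0 (inv_mul_cancel₀ hq0.ne') h1]
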